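/- Balls and bins process. There are $K'$ bins, initially empty, and at most $K$ balls may be present at any time. Each of the first $K$ steps inserts a new ball; every later step either inserts a new ball or removes a ball that is present, and the number of balls present never exceeds $K$. An oblivious adversary fixes in advance the whole sequence of insertions and deletions (a deletion names the ball to be removed by its time of insertion), without knowledge of the random choices. Each inserted ball draws two bins independently and uniformly at random, with replacement, and is placed in the one that currently holds fewer balls (the first one drawn in case of a tie). Theorem. There are absolute constants $A,B>0$ such that for all fixed constants $c_1,c_2$ there is a function $\varepsilon$ with $\varepsilon(K')=o\big(1/(K')^{c_1}\big)$ as $K'\to\infty$, depending only on $c_1,c_2$, such that the following holds for all $K'\ge 2$ and all $K$ with $(K')^{c_2}>K$. If the process runs for at most $(K')^{c_2}$ steps, then for every sequence fixed by the adversary, with probability at least $1-\varepsilon(K')$, the maximum load of a bin is at all times during the process at most $$A\,\frac{K}{K'}+\frac{\ln\ln K'}{\ln 2}+B\,(c_1+c_2).$$ Consequently, the rate of the decentralized caching scheme degrades by at most a constant factor. Let bins be the $K'$ cache contents of a centralized scheme of worst-case rate $R\ge 0$ and let balls be users. Delivery consists of repeated calls of the centralized scheme, each of rate $R$; each call serves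 one not yet served user of every cache content that still has such users, until all users are served, and the rate of the decentralized scheme is $R$ times the number of calls. Then there is a constant $D>0$ depending only on $c_1,c_2$ such that, on the same event, at all times during the process and for every $R\ge0$ this rate is at most $$D\cdot R\left(\frac{K}{K'}+\frac{\ln\ln K'}{\ln 2}+9\right),$$ that is, $D$ times the high-probability guarantee for the system without arrivals and departures. -/

import Mathlib

open Filter Asymptotics ProbabilityTheory

namespace TwoChoice

/-- One step of the adversary's sequence: either insert a new ball, or delete the ball that was
inserted at step `j`. Balls are named by the (zero-based) step of their insertion. -/
inductive Request where
  | insert : Request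
  | delete (j : ℕ) : Request

/-- The balls present after `t` steps. They are determined by the request sequence alone. -/
def present {T : ℕ} (req : Fin T → Request) : ℕ → Finset ℕ
  | 0 => ∅
  | t + 1 =>
    if h : t < T then
      match req ⟨t, h⟩ with
      | .insert => Insert.insert t (present req t)
      | .delete j => (present req t).erase j
    else present req t

/-- The request sequences of length `T` that are allowed when at most `K` balls may be present:
the first `K` steps are insertions, every deletion removes a ball that is present, and the number
of balls present never exceeds `K`. -/
structure Admissible (K : ℕ) {T : ℕ} (req : Fin T → Request) : Prop where
  initial : ∀ t : Fin T, (t : ℕ) < K → req t = Request.insert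
  delete_present : ∀ (t : Fin T) (j : ℕ), req t = Request.delete j → j ∈ present req t
  card_le : ∀ t ≤ T, (present req t).card ≤ K

/-- A configuration of balls in `n` bins: the set of pairs (ball, bin containing it). -/
abbrev Config (n : ℕ) := Finset (ℕ × Fin n)

/-- The number of balls in bin `b`. -/
def load {n : ℕ} (S : Config n) (b : Fin n) : ℕ := (S.filter fun p => p.2 = b).card

/-- The largest number of balls in a bin. -/
def maxLoad {n : ℕ} (S : Config n) : ℕ := Finset.univ.sup (load S)

/-- The less loaded of the two bins drawn; the first one in case of a tie. -/
def chosenBin {n : ℕ} (S : Config n) (c : Fin n × Fin n) : Fin n :=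
  if load S c.1 ≤ load S c.2 then c.1 else c.2

/-- The configuration after `t` steps, starting from empty bins, when `ω s` is the pair of bins
drawn at step `s` (the pair is not used if step `s` is a deletion). -/
def config {n T : ℕ} (req : Fin T → Request) (ω : Fin T → Fin n × Fin n) : ℕ → Config n
  | 0 => ∅
  | t + 1 =>
    if h : t < T then
      match req ⟨t, h⟩ with
      | .insert =>
        Insert.insert (t, chosenBin (config req ω t) (ω ⟨t, h⟩)) (config req ω t)
      | .delete j => (config req ω t).filter fun p => p.1 ≠ j
    else config req ω t

/-- The law of the draws: `T` independent pairs of independent uniformly distributed bins, that is,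
the uniform distribution on all sequences of `T` pairs. -/
noncomputable def drawLaw (n T : ℕ) : MeasureTheory.Measure (Fin T → Fin n × Fin n) :=
  uniformOn Set.univ

/-- One delivery call serves one waiting user from every bin (cache content) that still has
waiting users. -/
def serveOnce {n : ℕ} (X : Fin n → ℕ) : Fin n → ℕ := fun b => X b - 1

/-- The number of delivery calls until no user is waiting, if `X b` users store cache content
`b`. -/
noncomputable def deliveryCalls {n : ℕ} (X : Fin n → ℕ) : ℕ :=
  sInf {r | ∀ b, (serveOnce^[r] X) b = 0}

/-- The rate of the decentralized delivery scheme: every call costs the worst-case rate `R` of the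
underlying centralized scheme. -/
noncomputable def deliveryRate {n : ℕ} (R : ℝ) (X : Fin n → ℕ) : ℝ := R * deliveryCalls X

end TwoChoice

/-!
The proof is a layered induction over load thresholds `h₀ < h₁ < ⋯`. Call a ball high for `h` if
both bins drawn for it held at least `h` balls when it was inserted (`IsHigh`).

A ball that is not high goes to a bin with fewer than `h` balls, and deletions only remove balls,
so no bin ever contains more than `h` balls that are not high (`card_not_isHigh_le`). Hence, if more
than `b'` bins hold `h + r` balls, then at least `(b' + 1) * r` of the balls present are high for
`h`. If at most `b` of the `n` bins ever hold `h` balls, then a ball is high with conditional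
probability at most `(b / n) ^ 2` given the past. The adversary is oblivious, so the balls present
at a given time form a fixed set of at most `K` balls, and the probability that `m` of them are
high is at most `K.choose m * (b / n) ^ (2 * m)` (`drawLaw_real_fewHigh_diff_le`, based on
`drawLaw_real_highEvent_le`).

Put `a = K / n + 1`. At most half of the bins ever hold `2 * a` balls. With steps
`r_j = 64 * a / 2 ^ j + 1` the number of bins over the `j`-th threshold stays below
`n / 2 ^ (2 ^ j + j) + L` (`layer_recursion`), where the floor `L ≈ n ^ (1 / 4)` makes the failure
probability of each layer smaller than any power of `n`. After `J ≈ log₂ log₂ n` layers only about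
`L` bins are left, and since `L ^ 2 / n` is at most about `n ^ (- 1 / 2)`, a last step of
`a + ⌈4 * (c₁ + c₂ + 1)⌉` balls leaves none with the required probability. The steps decrease
geometrically, so they add up to `O(a) + J`, in which the coefficient of `log₂ log₂ n` is `1`.

The constant terms are absorbed by `B * (c₁ + c₂)` when `c₁ + c₂` is at least `1 / 4`. If it is
smaller (with `0 ≤ c₁` and `0 < c₂`), then there are so few balls that no bin ever holds two of them
(`no_collision_bound`). If `c₂ ≤ 0` there are no balls, and if `c₁ < 0` the failure probability `1`
is allowed. The number of delivery calls is the maximum load (`deliveryCalls_load`), so the rate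
bound holds on the same event.
-/

namespace TwoChoice

open MeasureTheory

variable {n T : ℕ}

/-! ### Deterministic facts about the process -/

theorem config_update (req : Fin T → Request) (ω : Fin T → Fin n × Fin n) (s : Fin T)
    (c : Fin n × Fin n) (t : ℕ) (ht : t ≤ s) :
    config req (Function.update ω s c) t = config req ω t := by
  induction t with
  | zero => rfl
  | succ t ih =>
    have hts : (⟨t, by omega⟩ : Fin T) ≠ s := fun h => by
      have := congrArg Fin.val h
      simp only at this
      omega
    simp only [config, ih (by omega), Function.update_of_ne hts]

theorem fst_lt_of_mem_config {req : Fin T → Request} {ω : Fin T → Fin n × Fin n} {t : ℕ}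
    {p : ℕ × Fin n} (hp : p ∈ config req ω t) : p.1 < t ∧ p.1 < T := by
  induction t with
  | zero => simp [config] at hp
  | succ t ih =>
    rw [config] at hp
    split_ifs at hp with h
    · split at hp
      · rcases Finset.mem_insert.1 hp with rfl | hp
        · exact ⟨Nat.lt_succ_self t, h⟩
        · exact ⟨(ih hp).1.trans (Nat.lt_succ_self t), (ih hp).2⟩
      · have := ih (Finset.mem_filter.1 hp).1
        exact ⟨this.1.trans (Nat.lt_succ_self t), this.2⟩
    · exact ⟨(ih hp).1.trans (Nat.lt_succ_self t), (ih hp).2⟩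

theorem fst_mem_present_of_mem_config {req : Fin T → Request} {ω : Fin T → Fin n × Fin n} {t : ℕ}
    {p : ℕ × Fin n} (hp : p ∈ config req ω t) : p.1 ∈ present req t := by
  induction t with
  | zero => simp [config] at hp
  | succ t ih =>
    rw [config] at hp
    rw [present]
    split_ifs at hp ⊢ with h
    · cases hr : req ⟨t, h⟩ with
      | insert =>
        simp only [hr, Finset.mem_insert] at hp ⊢
        rcases hp with rfl | hp
        · exact Or.inl rfl
        · exact Or.inr (ih hp)
      | delete j =>
        simp only [hr, Finset.mem_filter, Finset.mem_erase] at hp ⊢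
        exact ⟨hp.2, ih hp.1⟩
    · exact ih hp

theorem injOn_fst_config (req : Fin T → Request) (ω : Fin T → Fin n × Fin n) (t : ℕ) :
    Set.InjOn Prod.fst (config req ω t : Set (ℕ × Fin n)) := by
  induction t with
  | zero => simp [config]
  | succ t ih =>
    rw [config]
    split_ifs with h
    · split
      · rw [Finset.coe_insert, Set.injOn_insert]
        · refine ⟨ih, ?_⟩
          rintro ⟨p, hp, h⟩
          have := (fst_lt_of_mem_config (Finset.mem_coe.1 hp)).1
          simp only at h
          omega
        · intro hp
          exact lt_irrefl t (fst_lt_of_mem_config (Finset.mem_coe.1 hp)).1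
      · exact ih.mono (Finset.coe_subset.2 (Finset.filter_subset _ _))
    · exact ih

theorem present_lt {req : Fin T → Request} {t s : ℕ} (hs : s ∈ present req t) : s < T := by
  induction t with
  | zero => simp [present] at hs
  | succ t ih =>
    rw [present] at hs
    split_ifs at hs with h
    · split at hs
      · rcases Finset.mem_insert.1 hs with rfl | hs
        · exact h
        · exact ih hs
      · exact ih (Finset.mem_of_mem_erase hs)
    · exact ih hs

/-- The bins that hold at least `h` balls. -/
def highBins (S : Config n) (h : ℕ) : Finset (Fin n) := Finset.univ.filter fun b => h ≤ load S b

/-- Both bins drawn at step `s` held at least `h` balls just before step `s`. If step `s` is an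
insertion, this says that the inserted ball was put on top of at least `h` balls. -/
def IsHigh (req : Fin T → Request) (ω : Fin T → Fin n × Fin n) (h s : ℕ) : Prop :=
  ∃ hs : s < T, (ω ⟨s, hs⟩).1 ∈ highBins (config req ω s) h ∧
    (ω ⟨s, hs⟩).2 ∈ highBins (config req ω s) h

open Classical in
/-- A bin never holds more than `h` balls that are not high. This replaces the ordering of the
balls of a bin by height, and it survives deletions because a deletion can only decrease
the number of such balls. -/
theorem card_not_isHigh_le (req : Fin T → Request) (ω : Fin T → Fin n × Fin n) (h t : ℕ)
    (b : Fin n) :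
    ((config req ω t).filter fun p => p.2 = b ∧ ¬ IsHigh req ω h p.1).card ≤ h := by
  induction t with
  | zero => simp [config]
  | succ t ih =>
    rw [config]
    split_ifs with hT
    · split
      · rw [Finset.filter_insert]
        split_ifs with hc
        · obtain ⟨rfl, hc⟩ := hc
          -- A ball that is not high goes to a bin with fewer than `h` balls.
          have hlt : load (config req ω t) (chosenBin (config req ω t) (ω ⟨t, hT⟩)) < h := by
            by_contra! hle
            refine hc ⟨hT, ?_⟩
            unfold chosenBin at hle
            simp only [highBins, Finset.mem_filter, Finset.mem_univ, true_and]
            split_ifs at hle <;> omega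
          refine (Finset.card_insert_le _ _).trans ?_
          refine Nat.succ_le_of_lt (lt_of_le_of_lt (Finset.card_le_card ?_) hlt)
          exact Finset.monotone_filter_right _ fun p _ hp => hp.1
        · exact ih
      · exact (Finset.card_le_card (Finset.filter_subset_filter _ (Finset.filter_subset _ _))).trans
          ih
    · exact ih

open Classical in
theorem card_highBins_mul_le (req : Fin T → Request) (ω : Fin T → Fin n × Fin n) (h r t : ℕ) :
    (highBins (config req ω t) (h + r)).card * r ≤
      ((present req t).filter (IsHigh req ω h)).card := by
  set S := config req ω t with hS
  calc (highBins S (h + r)).card * r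
      = ∑ b ∈ highBins S (h + r), r := by simp
    _ ≤ ∑ b ∈ highBins S (h + r), (S.filter fun p => p.2 = b ∧ IsHigh req ω h p.1).card := by
        refine Finset.sum_le_sum fun b hb => ?_
        have h1 := card_not_isHigh_le req ω h t b
        have h2 : h + r ≤ load S b := (Finset.mem_filter.1 hb).2
        have h3 := Finset.card_filter_add_card_filter_not (s := S.filter fun p => p.2 = b)
          (fun p => IsHigh req ω h p.1)
        rw [Finset.filter_filter, Finset.filter_filter] at h3
        rw [← hS] at h1
        unfold load at h2
        omega
    _ ≤ ∑ b, ((S.filter fun p => IsHigh req ω h p.1).filter fun p => p.2 = b).card := by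
        refine (Finset.sum_le_sum_of_subset (Finset.subset_univ _)).trans
          (Finset.sum_le_sum fun b _ => ?_)
        rw [Finset.filter_filter]
        exact Finset.card_le_card (Finset.monotone_filter_right _ fun p _ hp => ⟨hp.2, hp.1⟩)
    _ = (S.filter fun p => IsHigh req ω h p.1).card :=
        (Finset.card_eq_sum_card_fiberwise fun p _ => Finset.mem_coe.2 (Finset.mem_univ p.2)).symm
    _ ≤ _ := by
        refine Finset.card_le_card_of_injOn Prod.fst (fun p hp => ?_)
          ((injOn_fst_config req ω t).mono (Finset.coe_subset.2 (Finset.filter_subset _ _)))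
        rw [Finset.mem_coe, Finset.mem_filter] at hp ⊢
        exact ⟨fst_mem_present_of_mem_config hp.1, hp.2⟩

theorem card_highBins_mul_le_card_present (req : Fin T → Request) (ω : Fin T → Fin n × Fin n)
    (h t : ℕ) : (highBins (config req ω t) h).card * h ≤ (present req t).card := by
  classical
  have := card_highBins_mul_le req ω 0 h t
  rw [Nat.zero_add] at this
  exact this.trans (Finset.card_le_card (Finset.filter_subset _ _))

theorem highBins_nonempty_of_le_maxLoad {S : Config n} {h : ℕ} (h0 : 0 < h) (hh : h ≤ maxLoad S) :
    (highBins S h).Nonempty := by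
  obtain ⟨b, hb, hle⟩ := (Finset.le_sup_iff (a := h) (by simpa using h0)).1 hh
  exact ⟨b, Finset.mem_filter.2 ⟨hb, hle⟩⟩

/-- Every delivery call lowers all nonzero loads by one, so the number of calls is the largest
load. -/
theorem deliveryCalls_load (S : Config n) : deliveryCalls (load S) = maxLoad S := by
  have hiter (X : Fin n → ℕ) (r : ℕ) : serveOnce^[r] X = fun b => X b - r := by
    induction r with
    | zero => rfl
    | succ r ih =>
      rw [Function.iterate_succ_apply', ih]
      funext b
      simp only [serveOnce]
      omega
  have hset : {r | ∀ b, (serveOnce^[r] (load S)) b = 0} = Set.Ici (maxLoad S) := by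
    ext r
    simp [hiter, maxLoad, Finset.sup_le_iff, Nat.sub_eq_zero_iff_le]
  rw [deliveryCalls, hset, csInf_Ici]

/-! ### Tail bounds for high balls -/

theorem drawLaw_real [NeZero n] (E : Finset (Fin T → Fin n × Fin n)) :
    (drawLaw n T).real E = E.card / Fintype.card (Fin T → Fin n × Fin n) := by
  rw [drawLaw, measureReal_def, uniformOn_univ, Measure.count_apply_finset]
  simp

instance [NeZero n] : IsProbabilityMeasure (drawLaw n T) :=
  isProbabilityMeasure_uniformOn Set.finite_univ Set.univ_nonempty

/-- If neither the event `A` nor the random set `G` depends on the draw at step `s`, then that draw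
falls into `G` independently of `A`. -/
theorem drawLaw_real_inter_le [NeZero n] (s : Fin T) (A : Set (Fin T → Fin n × Fin n))
    (G : (Fin T → Fin n × Fin n) → Finset (Fin n × Fin n)) (g : ℕ)
    (hA : ∀ ω c, ω ∈ A → Function.update ω s c ∈ A)
    (hG : ∀ ω c, G (Function.update ω s c) = G ω) (hg : ∀ ω ∈ A, (G ω).card ≤ g) :
    (drawLaw n T).real {ω | ω ∈ A ∧ ω s ∈ G ω} ≤ g / (n : ℝ) ^ 2 * (drawLaw n T).real A := by
  classical
  have h1 : {ω | ω ∈ A ∧ ω s ∈ G ω} =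
      ((Finset.univ.filter fun ω => ω ∈ A ∧ ω s ∈ G ω : Finset (Fin T → Fin n × Fin n)) : Set _) := by
    simp
  have h2 : A = ((Finset.univ.filter fun ω => ω ∈ A : Finset (Fin T → Fin n × Fin n)) : Set _) := by
    simp
  rw [h1]
  conv_rhs => rw [h2]
  rw [drawLaw_real, drawLaw_real]
  -- Swapping the draw `ω s` with an auxiliary draw `c` is injective and moves the constraint
  -- from `ω s` to `c`.
  have key : (Finset.univ.filter fun ω => ω ∈ A ∧ ω s ∈ G ω).card * n ^ 2 ≤
      g * (Finset.univ.filter fun ω => ω ∈ A).card := by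
    calc (Finset.univ.filter fun ω => ω ∈ A ∧ ω s ∈ G ω).card * n ^ 2
        = ((Finset.univ.filter fun ω => ω ∈ A ∧ ω s ∈ G ω) ×ˢ
            (Finset.univ : Finset (Fin n × Fin n))).card := by
          simp [Finset.card_product, sq]
      _ ≤ ((Finset.univ.filter fun ω => ω ∈ A).sigma G).card := by
          refine Finset.card_le_card_of_injOn
            (fun q => ⟨Function.update q.1 s q.2, q.1 s⟩) ?_ ?_
          · rintro ⟨ω, c⟩ hq
            simp only [Finset.coe_product, Set.mem_prod, Finset.mem_coe, Finset.mem_filter,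
              Finset.mem_univ, true_and, and_true] at hq
            simp only [Finset.mem_coe, Finset.mem_sigma, Finset.mem_filter, Finset.mem_univ,
              true_and, hG]
            exact ⟨hA _ _ hq.1, hq.2⟩
          · rintro ⟨ω, c⟩ - ⟨ω', c'⟩ - h
            simp only [Sigma.mk.injEq, heq_eq_eq] at h
            obtain ⟨h, h'⟩ := h
            have hc : c = c' := by simpa using congrFun h s
            have hω : ω = ω' := by
              funext i
              by_cases hi : i = s
              · rw [hi, h']
              · simpa [hi] using congrFun h i
            rw [hc, hω]
      _ = ∑ ω with ω ∈ A, (G ω).card := Finset.card_sigma _ _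
      _ ≤ ∑ ω with ω ∈ A, g := Finset.sum_le_sum fun ω hω => hg ω (Finset.mem_filter.1 hω).2
      _ = _ := by rw [Finset.sum_const, smul_eq_mul, mul_comm]
  have hn : (0 : ℝ) < (n : ℝ) ^ 2 := by
    have := NeZero.pos n
    positivity
  have key' : ((Finset.univ.filter fun ω => ω ∈ A ∧ ω s ∈ G ω).card : ℝ) * (n : ℝ) ^ 2 ≤
      g * (Finset.univ.filter fun ω => ω ∈ A).card := by exact_mod_cast key
  rw [← mul_div_assoc]
  refine div_le_div_of_nonneg_right ?_ (Nat.cast_nonneg _)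
  rw [div_mul_eq_mul_div, le_div_iff₀ hn]
  exact key'

/-- The event that all the steps in `S` are high for `h` although at each of them at most `b` bins
hold `h` balls. -/
def highEvent (req : Fin T → Request) (h b : ℕ) (S : Finset ℕ) : Set (Fin T → Fin n × Fin n) :=
  {ω | ∀ s ∈ S, (highBins (config req ω s) h).card ≤ b ∧ IsHigh req ω h s}

theorem drawLaw_real_highEvent_le [NeZero n] (req : Fin T → Request) (h b : ℕ) (S : Finset ℕ) :
    (drawLaw n T).real (highEvent req h b S) ≤ ((b : ℝ) / n) ^ (2 * S.card) := by
  induction S using Finset.induction_on_max with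
  | empty => simp [highEvent]
  | insert s S hs ih =>
    have hsS : s ∉ S := fun h => lt_irrefl s (hs s h)
    by_cases hsT : s < T
    · set A : Set (Fin T → Fin n × Fin n) :=
        {ω | ω ∈ highEvent req h b S ∧ (highBins (config req ω s) h).card ≤ b} with hAdef
      have hcfg (ω : Fin T → Fin n × Fin n) (c) (t : ℕ) (ht : t ≤ s) :
          config req (Function.update ω ⟨s, hsT⟩ c) t = config req ω t :=
        config_update req ω ⟨s, hsT⟩ c t ht
      have hle := drawLaw_real_inter_le (n := n) ⟨s, hsT⟩ A
        (fun ω => highBins (config req ω s) h ×ˢ highBins (config req ω s) h) (b ^ 2)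
        (by
          rintro ω c ⟨hω, hb⟩
          refine ⟨fun u hu => ?_, by rwa [hcfg ω c s le_rfl]⟩
          obtain ⟨hub, huT, hu'⟩ := hω u hu
          have hne : (⟨u, huT⟩ : Fin T) ≠ ⟨s, hsT⟩ := fun h => (hs u hu).ne (congrArg Fin.val h)
          refine ⟨by rwa [hcfg ω c u (hs u hu).le], huT, ?_⟩
          rwa [hcfg ω c u (hs u hu).le, Function.update_of_ne hne])
        (fun ω c => by simp only [hcfg ω c s le_rfl])
        (fun ω hω => by
          rw [Finset.card_product, sq]
          exact Nat.mul_le_mul hω.2 hω.2)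
      calc (drawLaw n T).real (highEvent req h b (insert s S))
          ≤ (drawLaw n T).real {ω | ω ∈ A ∧ ω ⟨s, hsT⟩ ∈
              highBins (config req ω s) h ×ˢ highBins (config req ω s) h} := by
            refine measureReal_mono ?_
            intro ω hω
            obtain ⟨h1, h2, h3⟩ := hω s (Finset.mem_insert_self s S)
            exact ⟨⟨fun u hu => hω u (Finset.mem_insert_of_mem hu), h1⟩, Finset.mem_product.2 h3⟩
        _ ≤ ((b ^ 2 : ℕ) : ℝ) / (n : ℝ) ^ 2 * (drawLaw n T).real A := hle
        _ ≤ ((b ^ 2 : ℕ) : ℝ) / (n : ℝ) ^ 2 * ((b : ℝ) / n) ^ (2 * S.card) := by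
            gcongr
            exact (measureReal_mono fun ω hω => hω.1).trans ih
        _ = _ := by
            rw [Finset.card_insert_of_notMem hsS, Nat.cast_pow, ← div_pow, ← pow_add]
            congr 1
            ring
    · have : highEvent req h b (insert s S) = (∅ : Set (Fin T → Fin n × Fin n)) := by
        ext ω
        simp only [Set.mem_empty_iff_false, iff_false]
        intro hω
        exact hsT (hω s (Finset.mem_insert_self s S)).2.1
      rw [this]
      simp only [measureReal_empty]
      positivity

/-- The event that at all times at most `b` bins hold `h` balls or more. -/
def fewHigh (req : Fin T → Request) (h b : ℕ) : Set (Fin T → Fin n × Fin n) :=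
  {ω | ∀ t ≤ T, (highBins (config req ω t) h).card ≤ b}

/-- A binomial tail estimate from `(m / 3) ^ m ≤ m!`: the tail beyond `m` is geometric once `m`
exceeds three times the mean `K * p`. -/
theorem choose_mul_pow_le (K m : ℕ) (hm : 0 < m) (p q : ℝ) (hp : 0 ≤ p)
    (hq : 3 * K * p ≤ q * m) : (K.choose m : ℝ) * p ^ m ≤ q ^ m := by
  have hm' : (0 : ℝ) < m := by exact_mod_cast hm
  have h1 : (K.choose m : ℝ) ≤ (K : ℝ) ^ m / m.factorial := Nat.choose_le_pow_div m K
  have h2 : (m : ℝ) ^ m / m.factorial ≤ 3 ^ m := by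
    refine (Real.pow_div_factorial_le_exp (m : ℝ) hm'.le m).trans ?_
    rw [← Real.exp_one_pow]
    gcongr
    exact Real.exp_one_lt_d9.le.trans (by norm_num)
  have h3 : (1 : ℝ) / m.factorial ≤ (3 / m) ^ m := by
    rw [div_pow, le_div_iff₀ (by positivity)]
    calc (1 : ℝ) / m.factorial * (m : ℝ) ^ m = (m : ℝ) ^ m / m.factorial := by ring
      _ ≤ 3 ^ m := h2
  calc (K.choose m : ℝ) * p ^ m ≤ (K : ℝ) ^ m / m.factorial * p ^ m := by gcongr
    _ = ((K : ℝ) * p) ^ m * (1 / m.factorial) := by rw [mul_pow]; ring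
    _ ≤ ((K : ℝ) * p) ^ m * (3 / m) ^ m := by gcongr
    _ = (3 * K * p / m) ^ m := by rw [← mul_pow]; ring
    _ ≤ q ^ m := by
        gcongr
        rwa [div_le_iff₀ hm']

/-- One layer of the induction: the balls present at a given time are a fixed set of at most `K`
balls, so their number of high balls is dominated by a binomial variable. -/
theorem drawLaw_real_fewHigh_diff_le [NeZero n] {K : ℕ} {req : Fin T → Request}
    (hreq : Admissible K req) (h b r b' m : ℕ) (hm : 0 < m) (hmr : m ≤ (b' + 1) * r) (q : ℝ)
    (hq : 3 * K * ((b : ℝ) / n) ^ 2 ≤ q * m) :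
    (drawLaw n T).real (fewHigh req h b \ fewHigh req (h + r) b') ≤ (T + 1) * q ^ m := by
  classical
  have hsub : (fewHigh req h b \ fewHigh req (h + r) b' : Set (Fin T → Fin n × Fin n)) ⊆
      ⋃ t ∈ Finset.range (T + 1), ⋃ S ∈ (present req t).powersetCard m, highEvent req h b S := by
    rintro ω ⟨hω, hω'⟩
    simp only [fewHigh, Set.mem_ofPred_eq, not_forall, not_le] at hω'
    obtain ⟨t, ht, htb⟩ := hω'
    have hcard : m ≤ ((present req t).filter (IsHigh req ω h)).card :=
      hmr.trans ((Nat.mul_le_mul_right r htb).trans (card_highBins_mul_le req ω h r t))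
    obtain ⟨S, hS, hSm⟩ := Finset.exists_subset_card_eq hcard
    simp only [Set.mem_iUnion, Finset.mem_range, Finset.mem_powersetCard, exists_prop]
    refine ⟨t, by omega, S, ⟨hS.trans (Finset.filter_subset _ _), hSm⟩, fun s hs => ?_⟩
    have := Finset.mem_filter.1 (hS hs)
    exact ⟨hω s (present_lt this.1).le, this.2⟩
  calc (drawLaw n T).real (fewHigh req h b \ fewHigh req (h + r) b')
      ≤ _ := measureReal_mono hsub (measure_ne_top _ _)
    _ ≤ ∑ t ∈ Finset.range (T + 1), (drawLaw n T).real
          (⋃ S ∈ (present req t).powersetCard m, highEvent req h b S) :=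
        measureReal_biUnion_finset_le _ _
    _ ≤ ∑ t ∈ Finset.range (T + 1), q ^ m := by
        refine Finset.sum_le_sum fun t ht => ?_
        calc (drawLaw n T).real (⋃ S ∈ (present req t).powersetCard m, highEvent req h b S)
            ≤ ∑ S ∈ (present req t).powersetCard m, (drawLaw n T).real (highEvent req h b S) :=
              measureReal_biUnion_finset_le _ _
          _ ≤ ∑ S ∈ (present req t).powersetCard m, (((b : ℝ) / n) ^ 2) ^ m := by
              refine Finset.sum_le_sum fun S hS => ?_
              have := drawLaw_real_highEvent_le (n := n) req h b S
              rwa [(Finset.mem_powersetCard.1 hS).2, pow_mul] at this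
          _ = ((present req t).card.choose m : ℝ) * (((b : ℝ) / n) ^ 2) ^ m := by
              rw [Finset.sum_const, Finset.card_powersetCard, nsmul_eq_mul]
          _ ≤ (K.choose m : ℝ) * (((b : ℝ) / n) ^ 2) ^ m := by
              gcongr
              exact hreq.card_le t (by simpa [Nat.lt_succ_iff] using ht)
          _ ≤ q ^ m := choose_mul_pow_le K m hm _ q (by positivity) hq
    _ = _ := by simp

/-! ### Iterating the layers -/

/-- The number of balls per bin between the thresholds of layers `j` and `j + 1`. It decreases
geometrically, so that the thresholds add up to a multiple of `a` plus the number of layers. -/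
def layerStep (a j : ℕ) : ℕ := 64 * a / 2 ^ j + 1

/-- The load threshold of layer `j`. -/
def layerHeight (a j : ℕ) : ℕ := 2 * a + ∑ i ∈ Finset.range j, layerStep a i

/-- The number of bins allowed to reach the threshold of layer `j`: a doubly exponentially
decreasing fraction of the bins, with a floor `L` below which the tail bounds would be too weak. -/
def layerBound (n L j : ℕ) : ℕ := n / 2 ^ (2 ^ j + j) + L

theorem layerHeight_le (a j : ℕ) : layerHeight a j ≤ 130 * a + j := by
  have h : ((∑ i ∈ Finset.range j, 64 * a / 2 ^ i : ℕ) : ℝ) ≤ (128 * a : ℕ) := by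
    push_cast
    calc ∑ i ∈ Finset.range j, ((64 * a / 2 ^ i : ℕ) : ℝ)
        ≤ ∑ i ∈ Finset.range j, 64 * a * (1 / 2 : ℝ) ^ i := by
          refine Finset.sum_le_sum fun i _ => Nat.cast_div_le.trans (le_of_eq ?_)
          push_cast
          rw [one_div, inv_pow, div_eq_mul_inv]
      _ = 64 * a * ∑ i ∈ Finset.range j, (1 / 2 : ℝ) ^ i := by rw [Finset.mul_sum]
      _ ≤ 64 * a * 2 := by
          gcongr
          exact sum_geometric_two_le j
      _ = 128 * a := by ring
  have h' : ∑ i ∈ Finset.range j, 64 * a / 2 ^ i ≤ 128 * a := by exact_mod_cast h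
  simp only [layerHeight, layerStep, Finset.sum_add_distrib, Finset.sum_const, Finset.card_range,
    smul_eq_mul, mul_one]
  omega

theorem fewHigh_layer_zero {K : ℕ} {req : Fin T → Request} (hreq : Admissible K req) (a L : ℕ)
    (ha : 0 < a) (hK : K ≤ a * n) :
    fewHigh req (layerHeight a 0) (layerBound n L 0) =
      (Set.univ : Set (Fin T → Fin n × Fin n)) := by
  refine Set.eq_univ_of_forall fun ω t ht => ?_
  have h1 := (card_highBins_mul_le_card_present req ω (2 * a) t).trans (hreq.card_le t ht)
  have h2 : (highBins (config req ω t) (2 * a)).card * 2 ≤ n := by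
    refine Nat.le_of_mul_le_mul_left ?_ ha
    calc _ = (highBins (config req ω t) (2 * a)).card * (2 * a) := by ring
      _ ≤ a * n := h1.trans hK
  simp only [layerHeight, layerBound, Finset.range_zero, Finset.sum_empty, add_zero, pow_zero,
    pow_one]
  omega

/-- The recursion for the numbers of bins. The probability that a ball is high for layer `j` is
at most `(layerBound n L j / n) ^ 2`, and more than `layerBound n L (j + 1)` bins over the next
threshold need `layerStep a j` high balls each. The latter total is at least six times the expected
number of high balls, which is what the tail bound needs. -/
theorem layer_recursion {K : ℕ} (a L j : ℕ) (hn : 0 < n) (hK : K ≤ a * n) (hL : L * 2 ^ j ≤ n) :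
    3 * K * ((layerBound n L j : ℝ) / n) ^ 2 ≤
      1 / 2 * (((layerBound n L (j + 1) + 1) * layerStep a j : ℕ) : ℝ) := by
  have hn' : (0 : ℝ) < n := by exact_mod_cast hn
  set u : ℝ := n / 2 ^ (2 ^ j + j) with hu
  set v : ℝ := n / 2 ^ (2 ^ (j + 1) + (j + 1)) with hv
  have hb : (layerBound n L j : ℝ) ≤ u + L := by
    rw [layerBound, Nat.cast_add]
    gcongr
    exact Nat.cast_div_le.trans (by push_cast; rfl)
  have hb' : v + L ≤ (layerBound n L (j + 1) : ℝ) + 1 := by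
    have : v ≤ ((n / 2 ^ (2 ^ (j + 1) + (j + 1)) : ℕ) : ℝ) + 1 := by
      rw [hv, div_le_iff₀ (by positivity)]
      have := Nat.lt_div_mul_add (a := n) (b := 2 ^ (2 ^ (j + 1) + (j + 1))) (by positivity)
      have h2 : n ≤ (n / 2 ^ (2 ^ (j + 1) + (j + 1)) + 1) * 2 ^ (2 ^ (j + 1) + (j + 1)) := by
        rw [Nat.add_mul, one_mul]
        exact this.le
      exact_mod_cast h2
    rw [layerBound, Nat.cast_add]
    linarith
  have hr : 64 * (a : ℝ) ≤ layerStep a j * 2 ^ j := by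
    have := Nat.lt_div_mul_add (a := 64 * a) (b := 2 ^ j) (by positivity)
    have h2 : 64 * a ≤ layerStep a j * 2 ^ j := by
      rw [layerStep, Nat.add_mul, one_mul]
      exact this.le
    exact_mod_cast h2
  have huv : u ^ 2 * 2 ^ j = 2 * n * v := by
    rw [hu, hv, div_pow, ← pow_mul]
    have : (2 : ℝ) ^ ((2 ^ j + j) * 2) * 2 = 2 ^ j * 2 ^ (2 ^ (j + 1) + (j + 1)) := by
      rw [← pow_succ, ← pow_add]
      congr 1
      ring
    field_simp
    linear_combination (-(1 : ℝ)) * this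
  have hL' : (L : ℝ) * 2 ^ j ≤ n := by exact_mod_cast hL
  have hK' : (K : ℝ) ≤ a * n := by exact_mod_cast hK
  have hu0 : 0 ≤ u := by positivity
  have hv0 : 0 ≤ v := by positivity
  -- Everything is compared after multiplication by `2 ^ j * n`.
  have hsq : (layerBound n L j : ℝ) ^ 2 * 2 ^ j ≤ 4 * n * v + 2 * L * n := by
    calc (layerBound n L j : ℝ) ^ 2 * 2 ^ j ≤ (u + L) ^ 2 * 2 ^ j := by gcongr
      _ ≤ (2 * u ^ 2 + 2 * L ^ 2) * 2 ^ j := by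
          gcongr
          nlinarith [sq_nonneg (u - L)]
      _ = 2 * (u ^ 2 * 2 ^ j) + 2 * L * (L * 2 ^ j) := by ring
      _ ≤ 2 * (2 * n * v) + 2 * L * n := by
          rw [huv]
          gcongr
      _ = _ := by ring
  have hmain : 6 * a * (layerBound n L j : ℝ) ^ 2 * 2 ^ j ≤
      n * ((layerBound n L (j + 1) : ℝ) + 1) * (layerStep a j * 2 ^ j) := by
    calc 6 * a * (layerBound n L j : ℝ) ^ 2 * 2 ^ j
        = 6 * a * ((layerBound n L j : ℝ) ^ 2 * 2 ^ j) := by ring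
      _ ≤ 6 * a * (4 * n * v + 2 * L * n) := by gcongr
      _ ≤ n * (v + L) * (64 * a) := by
          have h1 : 0 ≤ a * n * v := by positivity
          have h2 : 0 ≤ (a : ℝ) * n * L := by positivity
          nlinarith
      _ ≤ _ := by gcongr
  have hmain' : 6 * a * (layerBound n L j : ℝ) ^ 2 ≤
      n * (((layerBound n L (j + 1) : ℝ) + 1) * layerStep a j) := by
    refine le_of_mul_le_mul_right ?_ (show (0 : ℝ) < 2 ^ j by positivity)
    linarith
  push_cast
  calc 3 * K * ((layerBound n L j : ℝ) / n) ^ 2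
      ≤ 3 * (a * n) * ((layerBound n L j : ℝ) / n) ^ 2 := by gcongr
    _ = 1 / 2 * (6 * a * (layerBound n L j : ℝ) ^ 2) / n := by field_simp; ring
    _ ≤ 1 / 2 * (n * (((layerBound n L (j + 1) : ℝ) + 1) * layerStep a j)) / n := by gcongr
    _ = _ := by field_simp

theorem drawLaw_real_compl_le_add [NeZero n] (A B : Set (Fin T → Fin n × Fin n)) :
    (drawLaw n T).real Bᶜ ≤ (drawLaw n T).real Aᶜ + (drawLaw n T).real (A \ B) := by
  refine le_trans (measureReal_mono ?_ (measure_ne_top _ _)) (measureReal_union_le _ _)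
  intro ω hω
  by_cases h : ω ∈ A
  · exact Or.inr ⟨h, hω⟩
  · exact Or.inl h

theorem drawLaw_real_compl_layer_le [NeZero n] {K : ℕ} {req : Fin T → Request}
    (hreq : Admissible K req) (a L J : ℕ) (ha : 0 < a) (hK : K ≤ a * n)
    (hL : ∀ j < J, L * 2 ^ j ≤ n) :
    (drawLaw n T).real (fewHigh req (layerHeight a J) (layerBound n L J))ᶜ ≤
      J * ((T + 1) * (1 / 2) ^ L) := by
  induction J with
  | zero => simp [fewHigh_layer_zero hreq a L ha hK]
  | succ j ih =>
    have hstep := drawLaw_real_fewHigh_diff_le (n := n) hreq (layerHeight a j) (layerBound n L j)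
      (layerStep a j) (layerBound n L (j + 1)) ((layerBound n L (j + 1) + 1) * layerStep a j)
      (Nat.mul_pos (Nat.succ_pos _) (Nat.succ_pos _)) le_rfl (1 / 2)
      (layer_recursion a L j (NeZero.pos n) hK (hL j (Nat.lt_succ_self j)))
    have hheight : layerHeight a (j + 1) = layerHeight a j + layerStep a j := by
      rw [layerHeight, Finset.sum_range_succ, ← add_assoc, ← layerHeight]
    have hexp : L ≤ (layerBound n L (j + 1) + 1) * layerStep a j := by
      calc L ≤ layerBound n L (j + 1) + 1 := (Nat.le_add_left _ _).trans (Nat.le_succ _)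
        _ ≤ _ := Nat.le_mul_of_pos_right _ (Nat.succ_pos _)
    have hpow : ((1 : ℝ) / 2) ^ ((layerBound n L (j + 1) + 1) * layerStep a j) ≤ (1 / 2) ^ L :=
      pow_le_pow_of_le_one (by norm_num) (by norm_num) hexp
    have hstep' := hstep.trans (mul_le_mul_of_nonneg_left hpow (by positivity))
    rw [hheight]
    refine (drawLaw_real_compl_le_add (fewHigh req (layerHeight a j) (layerBound n L j)) _).trans ?_
    have := ih fun i hi => hL i (hi.trans (Nat.lt_succ_self j))
    push_cast
    linarith

/-- After `J` layers with `n ≤ 2 ^ 2 ^ J`, one more step of `a + r` balls empties the set of bins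
over the threshold. -/
theorem drawLaw_real_compl_final_le [NeZero n] {K : ℕ} {req : Fin T → Request}
    (hreq : Admissible K req) (a L J r : ℕ) (ha : 0 < a) (hK : K ≤ a * n)
    (hL : ∀ j < J, L * 2 ^ j ≤ n) (hL1 : 1 ≤ L) (hJ : n ≤ 2 ^ 2 ^ J) :
    (drawLaw n T).real (fewHigh req (layerHeight a J + (a + r)) 0)ᶜ ≤
      J * ((T + 1) * (1 / 2) ^ L) + (T + 1) * (12 * (L : ℝ) ^ 2 / n) ^ (a + r) := by
  have hn' : (0 : ℝ) < n := by exact_mod_cast NeZero.pos n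
  have hb : layerBound n L J ≤ 2 * L := by
    have : n / 2 ^ (2 ^ J + J) ≤ 1 := by
      refine Nat.div_le_of_le_mul ?_
      rw [mul_one]
      exact hJ.trans (Nat.pow_le_pow_right two_pos (Nat.le_add_right _ _))
    unfold layerBound
    omega
  have hq : 3 * K * ((layerBound n L J : ℝ) / n) ^ 2 ≤
      12 * (L : ℝ) ^ 2 / n * ((a + r : ℕ) : ℝ) := by
    have hb' : (layerBound n L J : ℝ) ≤ 2 * L := by exact_mod_cast hb
    have hK' : (K : ℝ) ≤ a * n := by exact_mod_cast hK
    calc 3 * K * ((layerBound n L J : ℝ) / n) ^ 2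
        ≤ 3 * (a * n) * ((2 * L : ℝ) / n) ^ 2 := by gcongr
      _ = 12 * (L : ℝ) ^ 2 / n * a := by field_simp; ring
      _ ≤ _ := by
          gcongr
          omega
  refine (drawLaw_real_compl_le_add (fewHigh req (layerHeight a J) (layerBound n L J)) _).trans ?_
  refine add_le_add (drawLaw_real_compl_layer_le hreq a L J ha hK hL) ?_
  exact drawLaw_real_fewHigh_diff_le hreq _ _ (a + r) 0 (a + r) (by omega) (by omega) _ hq

theorem maxLoad_lt_of_mem_fewHigh {req : Fin T → Request} {ω : Fin T → Fin n × Fin n} {h t : ℕ}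
    (hω : ω ∈ fewHigh req h 0) (h0 : 0 < h) (ht : t ≤ T) : maxLoad (config req ω t) < h := by
  by_contra! hle
  have := (highBins_nonempty_of_le_maxLoad h0 hle).card_pos
  have := hω t ht
  omega

theorem one_sub_le_drawLaw_real [NeZero n] {A B : Set (Fin T → Fin n × Fin n)} {x : ℝ}
    (hAB : A ⊆ B) (h : (drawLaw n T).real Aᶜ ≤ x) : 1 - x ≤ (drawLaw n T).real B := by
  have h1 : (drawLaw n T).real B ≥ (drawLaw n T).real A := measureReal_mono hAB
  have h2 := probReal_compl_eq_one_sub (μ := drawLaw n T) (s := A) (Set.toFinite A).measurableSet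
  linarith

/-! ### Choice of the parameters -/

theorem clog_two_le_log (hn : 2 ≤ n) : (Nat.clog 2 n : ℝ) ≤ 2 * Real.log n / Real.log 2 := by
  have hl2 : 0 < Real.log 2 := Real.log_pos one_lt_two
  have h1 : 2 ^ (Nat.clog 2 n).pred < n := Nat.pow_pred_clog_lt_self one_lt_two (by omega)
  have h2 : (2 : ℝ) ^ (Nat.clog 2 n).pred ≤ n := by exact_mod_cast h1.le
  have h3 := Real.log_le_log (by positivity) h2
  rw [Real.log_pow] at h3
  have h4 : Real.log 2 ≤ Real.log n := Real.log_le_log two_pos (by exact_mod_cast hn)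
  have h5 : (Nat.clog 2 n : ℝ) ≤ (Nat.clog 2 n).pred + 1 := by
    exact_mod_cast (by rw [Nat.pred_eq_sub_one]; omega :
      Nat.clog 2 n ≤ (Nat.clog 2 n).pred + 1)
  rw [le_div_iff₀ hl2]
  nlinarith

/-- The number of layers: the least `J` with `n ≤ 2 ^ 2 ^ J`. -/
def layerCount (n : ℕ) : ℕ := Nat.clog 2 (Nat.clog 2 n)

theorem le_two_pow_layerCount (n : ℕ) : n ≤ 2 ^ 2 ^ layerCount n :=
  (Nat.le_pow_clog one_lt_two n).trans
    (Nat.pow_le_pow_right two_pos (Nat.le_pow_clog one_lt_two _))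

theorem layerCount_le (hn : 3 ≤ n) :
    (layerCount n : ℝ) ≤ Real.log (Real.log n) / Real.log 2 + 3 := by
  have hl2 : 0 < Real.log 2 := Real.log_pos one_lt_two
  have hl2' : 1 / 2 < Real.log 2 := by
    have := Real.log_two_gt_d9
    linarith
  have hln : 0 < Real.log n := Real.log_pos (by exact_mod_cast (by omega : 1 < n))
  have h2 : 2 ≤ Nat.clog 2 n := by
    rw [← Nat.lt_iff_add_one_le, Nat.lt_clog_iff_pow_lt one_lt_two]
    omega
  have h3 := clog_two_le_log h2
  have h4 := clog_two_le_log (n := n) (by omega)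
  have h0 : (0 : ℝ) < Nat.clog 2 n := by exact_mod_cast (by omega : 0 < Nat.clog 2 n)
  have hJ : 2 ^ (layerCount n).pred < Nat.clog 2 n :=
    Nat.pow_pred_clog_lt_self one_lt_two (by omega)
  have hJ' : (2 : ℝ) ^ (layerCount n).pred ≤ 2 * Real.log n / Real.log 2 :=
    le_trans (by exact_mod_cast hJ.le) h4
  have h5 := Real.log_le_log (by positivity) hJ'
  rw [Real.log_pow, Real.log_div (by positivity) hl2.ne', Real.log_mul two_ne_zero hln.ne'] at h5
  have h6 : -Real.log (Real.log 2) ≤ Real.log 2 := by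
    rw [← Real.log_inv]
    refine Real.log_le_log (by positivity) ?_
    rw [inv_le_comm₀ hl2 two_pos]
    linarith
  have h7 : (layerCount n : ℝ) ≤ (layerCount n).pred + 1 := by
    exact_mod_cast (by rw [Nat.pred_eq_sub_one]; omega :
      layerCount n ≤ (layerCount n).pred + 1)
  rw [← sub_le_iff_le_add, le_div_iff₀ hl2]
  nlinarith

theorem two_pow_lt_clog_of_lt_layerCount {j : ℕ} (hj : j < layerCount n) :
    2 ^ j < Nat.clog 2 n := Nat.pow_lt_of_lt_clog hj

/-- The floor `L` of the layers. Any small power of `n` works. -/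
noncomputable def layerFloor (n : ℕ) : ℕ := ⌊(n : ℝ) ^ (1 / 4 : ℝ)⌋₊

theorem one_le_layerFloor (hn : 1 ≤ n) : 1 ≤ layerFloor n := by
  rw [layerFloor, Nat.one_le_floor_iff]
  exact Real.one_le_rpow (by exact_mod_cast hn) (by norm_num)

theorem eventually_layerFloor_mul_le :
    ∀ᶠ n : ℕ in atTop, ∀ j < layerCount n, layerFloor n * 2 ^ j ≤ n := by
  have h : ∀ᶠ x : ℝ in atTop, Real.log x ≤ Real.log 2 / 2 * x ^ (3 / 4 : ℝ) := by
    filter_upwards [(isLittleO_log_rpow_atTop (by norm_num : (0 : ℝ) < 3 / 4)).bound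
      (show 0 < Real.log 2 / 2 by have := Real.log_pos one_lt_two; positivity),
      eventually_ge_atTop 1] with x hx h1
    rwa [Real.norm_of_nonneg (Real.log_nonneg h1), Real.norm_of_nonneg (by positivity)] at hx
  filter_upwards [tendsto_natCast_atTop_atTop.eventually h, eventually_ge_atTop 2] with n hn h2 j hj
  have hl2 : 0 < Real.log 2 := Real.log_pos one_lt_two
  have hn0 : (0 : ℝ) < n := by exact_mod_cast (by omega : 0 < n)
  have h1 : (2 : ℝ) ^ j ≤ (n : ℝ) ^ (3 / 4 : ℝ) := by
    have : ((2 ^ j : ℕ) : ℝ) ≤ Nat.clog 2 n := by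
      exact_mod_cast (two_pow_lt_clog_of_lt_layerCount hj).le
    push_cast at this
    refine this.trans ((clog_two_le_log h2).trans ?_)
    rw [div_le_iff₀ hl2]
    linarith
  have h3 : (layerFloor n : ℝ) ≤ (n : ℝ) ^ (1 / 4 : ℝ) := Nat.floor_le (by positivity)
  have h4 : ((layerFloor n * 2 ^ j : ℕ) : ℝ) ≤ n := by
    push_cast
    calc (layerFloor n : ℝ) * 2 ^ j ≤ (n : ℝ) ^ (1 / 4 : ℝ) * (n : ℝ) ^ (3 / 4 : ℝ) := by gcongr
      _ = n := by
          rw [← Real.rpow_add hn0]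
          norm_num
  exact_mod_cast h4

/-- The failure probability of the layers is smaller than every power of `n`. -/
theorem eventually_layer_failure_le (s : ℝ) :
    ∀ᶠ n : ℕ in atTop, (n : ℝ) ^ s * (1 / 2) ^ layerFloor n ≤ 1 / 8 := by
  have hl2 : 0 < Real.log 2 := Real.log_pos one_lt_two
  have h1 : Tendsto (fun n : ℕ => (n : ℝ) ^ (1 / 4 : ℝ)) atTop atTop :=
    (tendsto_rpow_atTop (by norm_num)).comp tendsto_natCast_atTop_atTop
  have h2 := (tendsto_rpow_mul_exp_neg_mul_atTop_nhds_zero (4 * s) (Real.log 2) hl2).comp h1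
  filter_upwards [h2.eventually (gt_mem_nhds (show (0 : ℝ) < 1 / 16 by norm_num)),
    eventually_ge_atTop 1] with n hn hn1
  have hn0 : (0 : ℝ) < n := by exact_mod_cast hn1
  simp only [Function.comp_apply] at hn
  rw [← Real.rpow_mul hn0.le, show (1 / 4 : ℝ) * (4 * s) = s by ring] at hn
  have h3 : (n : ℝ) ^ (1 / 4 : ℝ) - 1 ≤ layerFloor n := (Nat.sub_one_lt_floor _).le
  have h4 : ((1 : ℝ) / 2) ^ layerFloor n ≤
      2 * Real.exp (-Real.log 2 * (n : ℝ) ^ (1 / 4 : ℝ)) := by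
    calc ((1 : ℝ) / 2) ^ layerFloor n = Real.exp (-Real.log 2 * layerFloor n) := by
          rw [mul_comm, Real.exp_nat_mul, Real.exp_neg, Real.exp_log two_pos, one_div]
      _ ≤ Real.exp (Real.log 2 + -Real.log 2 * (n : ℝ) ^ (1 / 4 : ℝ)) := by
          rw [Real.exp_le_exp]
          nlinarith
      _ = _ := by rw [Real.exp_add, Real.exp_log two_pos]
  calc (n : ℝ) ^ s * (1 / 2) ^ layerFloor n
      ≤ (n : ℝ) ^ s * (2 * Real.exp (-Real.log 2 * (n : ℝ) ^ (1 / 4 : ℝ))) := by gcongr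
    _ = 2 * ((n : ℝ) ^ s * Real.exp (-Real.log 2 * (n : ℝ) ^ (1 / 4 : ℝ))) := by ring
    _ ≤ 1 / 8 := by linarith

/-- The bound `12 ^ 4 ≤ n` lets `n ^ (1 / 4)` absorb the factor `12`. -/
theorem final_base_le (hn : 12 ^ 4 ≤ n) :
    12 * (layerFloor n : ℝ) ^ 2 / n ≤ (n : ℝ) ^ (-(1 / 4) : ℝ) := by
  have hn0 : (0 : ℝ) < n := by exact_mod_cast lt_of_lt_of_le (by norm_num) hn
  have h3 : (layerFloor n : ℝ) ≤ (n : ℝ) ^ (1 / 4 : ℝ) := Nat.floor_le (by positivity)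
  have h12 : (12 : ℝ) ≤ (n : ℝ) ^ (1 / 4 : ℝ) := by
    calc (12 : ℝ) = ((12 : ℝ) ^ 4) ^ (((4 : ℕ) : ℝ)⁻¹) :=
          (Real.pow_rpow_inv_natCast (by norm_num) (by norm_num)).symm
      _ ≤ (n : ℝ) ^ (((4 : ℕ) : ℝ)⁻¹) :=
          Real.rpow_le_rpow (by norm_num) (by exact_mod_cast hn) (by norm_num)
      _ = (n : ℝ) ^ (1 / 4 : ℝ) := by norm_num
  rw [div_le_iff₀ hn0]
  calc 12 * (layerFloor n : ℝ) ^ 2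
      ≤ (n : ℝ) ^ (1 / 4 : ℝ) * ((n : ℝ) ^ (1 / 4 : ℝ)) ^ 2 := by gcongr
    _ = ((n : ℝ) ^ (1 / 4 : ℝ)) ^ 3 := by ring
    _ = (n : ℝ) ^ (-(1 / 4) : ℝ) * n := by
        rw [← Real.rpow_natCast, ← Real.rpow_mul hn0.le]
        nth_rewrite 3 [← Real.rpow_one (n : ℝ)]
        rw [← Real.rpow_add hn0]
        norm_num

/-! ### The high-probability bound on the maximum load -/

theorem add_one_le_two_mul_rpow {c : ℝ} (hn : 1 ≤ n) (hc : 0 ≤ c) (hT : (T : ℝ) ≤ (n : ℝ) ^ c) :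
    (T : ℝ) + 1 ≤ 2 * (n : ℝ) ^ c := by
  have : (1 : ℝ) ≤ (n : ℝ) ^ c := Real.one_le_rpow (by exact_mod_cast hn) hc
  linarith

/-- For small exponents there are so few balls that no two of them ever share a bin. -/
theorem no_collision_bound {K : ℕ} {req : Fin T → Request} (hreq : Admissible K req) {c₁ c₂ : ℝ}
    (h₁ : 0 ≤ c₁) (h₂ : 0 < c₂) (hc : c₁ + c₂ ≤ 1 / 4) (hn : 36 ≤ n)
    (hK : (K : ℝ) < (n : ℝ) ^ c₂) (hT : (T : ℝ) ≤ (n : ℝ) ^ c₂) :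
    1 - (n : ℝ) ^ (-(c₁ + 1 / 2)) ≤ (drawLaw n T).real
      {ω | ∀ t ≤ T, maxLoad (config req ω t) ≤ 1} := by
  have : NeZero n := ⟨by omega⟩
  have hn0 : (0 : ℝ) < n := by exact_mod_cast (by omega : 0 < n)
  have hn1 : (1 : ℝ) ≤ n := by exact_mod_cast (by omega : 1 ≤ n)
  refine one_sub_le_drawLaw_real (A := fewHigh req (1 + 1) 0)
    (fun ω hω t ht => Nat.lt_succ_iff.1 (maxLoad_lt_of_mem_fewHigh hω (by norm_num) ht)) ?_
  have huniv : fewHigh req 1 K = (Set.univ : Set (Fin T → Fin n × Fin n)) :=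
    Set.eq_univ_of_forall fun ω t ht => by
      simpa using (card_highBins_mul_le_card_present req ω 1 t).trans (hreq.card_le t ht)
  have h := drawLaw_real_fewHigh_diff_le (n := n) hreq 1 K 1 0 1 one_pos le_rfl
    (3 * K * ((K : ℝ) / n) ^ 2) (by simp)
  rw [huniv, ← Set.compl_eq_univ_sdiff, pow_one] at h
  have hsix : 6 ≤ (n : ℝ) ^ (1 / 2 : ℝ) := by
    rw [← Real.sqrt_eq_rpow]
    refine Real.le_sqrt_of_sq_le ?_
    norm_num
    exact_mod_cast hn
  calc (drawLaw n T).real (fewHigh req (1 + 1) 0)ᶜ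
      ≤ (T + 1) * (3 * K * ((K : ℝ) / n) ^ 2) := h
    _ ≤ (2 * (n : ℝ) ^ c₂) * (3 * (n : ℝ) ^ c₂ * ((n : ℝ) ^ c₂ / n) ^ 2) := by
        gcongr
        exact add_one_le_two_mul_rpow (by omega) h₂.le hT
    _ = 6 * (n : ℝ) ^ (c₂ * (4 : ℕ) - (2 : ℕ)) := by
        rw [Real.rpow_sub hn0, Real.rpow_mul hn0.le, Real.rpow_natCast, Real.rpow_natCast]
        ring
    _ ≤ (n : ℝ) ^ (1 / 2 : ℝ) * (n : ℝ) ^ (-(c₁ + 1)) := by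
        gcongr ?_ * ?_
        refine Real.rpow_le_rpow_of_exponent_le hn1 ?_
        push_cast
        linarith
    _ = (n : ℝ) ^ (-(c₁ + 1 / 2)) := by
        rw [← Real.rpow_add hn0]
        congr 1
        ring

theorem eventually_failure_le {c₁ c₂ : ℝ} (h₂ : 0 < c₂) :
    ∀ᶠ n : ℕ in atTop, ∀ K T : ℕ, (T : ℝ) ≤ (n : ℝ) ^ c₂ →
      ∀ req : Fin T → Request, Admissible K req →
        (drawLaw n T).real (fewHigh req
          (layerHeight (K / n + 1) (layerCount n) + (K / n + 1 + ⌈4 * (c₁ + c₂ + 1)⌉₊)) 0)ᶜ ≤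
          (n : ℝ) ^ (-(c₁ + 1 / 2)) := by
  filter_upwards [eventually_layerFloor_mul_le, eventually_layer_failure_le (1 + c₂ + (c₁ + 1 / 2)),
    eventually_ge_atTop (12 ^ 4)] with n hL hfail hn K T hT req hreq
  have hn' : 20736 ≤ n := by norm_num at hn; exact hn
  have : NeZero n := ⟨by omega⟩
  have hn0 : (0 : ℝ) < n := by exact_mod_cast (by omega : 0 < n)
  have hn1 : (1 : ℝ) ≤ n := by exact_mod_cast (by omega : 1 ≤ n)
  have hK : K ≤ (K / n + 1) * n := by
    rw [Nat.add_mul, one_mul]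
    exact (Nat.lt_div_mul_add (by omega)).le
  refine (drawLaw_real_compl_final_le hreq (K / n + 1) (layerFloor n) (layerCount n)
    ⌈4 * (c₁ + c₂ + 1)⌉₊ (Nat.succ_pos _) hK hL (one_le_layerFloor (by omega))
    (le_two_pow_layerCount n)).trans ?_
  have hT' := add_one_le_two_mul_rpow (by omega : 1 ≤ n) h₂.le hT
  have hJ : (layerCount n : ℝ) ≤ n := by
    have h : layerCount n ≤ n := by
      refine Nat.clog_le_of_le_pow ((Nat.clog_le_of_le_pow ?_).trans Nat.lt_two_pow_self.le)
      exact Nat.lt_two_pow_self.le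
    exact_mod_cast h
  have hfour : 4 ≤ (n : ℝ) ^ (1 / 2 : ℝ) := by
    rw [← Real.sqrt_eq_rpow]
    refine Real.le_sqrt_of_sq_le ?_
    norm_num
    exact_mod_cast (by omega : 16 ≤ n)
  have hfirst : (layerCount n : ℝ) * ((T + 1) * (1 / 2) ^ layerFloor n) ≤
      1 / 4 * (n : ℝ) ^ (-(c₁ + 1 / 2)) := by
    calc (layerCount n : ℝ) * ((T + 1) * (1 / 2) ^ layerFloor n)
        ≤ n * (2 * (n : ℝ) ^ c₂ * (1 / 2) ^ layerFloor n) := by gcongr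
      _ = 2 * ((n : ℝ) ^ (1 + c₂ + (c₁ + 1 / 2)) * (1 / 2) ^ layerFloor n) *
            (n : ℝ) ^ (-(c₁ + 1 / 2)) := by
          have : (n : ℝ) * (n : ℝ) ^ c₂ =
              (n : ℝ) ^ (1 + c₂ + (c₁ + 1 / 2)) * (n : ℝ) ^ (-(c₁ + 1 / 2)) := by
            rw [← Real.rpow_add hn0, add_neg_cancel_right, Real.rpow_add hn0, Real.rpow_one]
          linear_combination (2 * (1 / 2 : ℝ) ^ layerFloor n) * this
      _ ≤ 2 * (1 / 8) * (n : ℝ) ^ (-(c₁ + 1 / 2)) := by gcongr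
      _ = _ := by ring
  have hpow : (12 * (layerFloor n : ℝ) ^ 2 / n) ^ (K / n + 1 + ⌈4 * (c₁ + c₂ + 1)⌉₊) ≤
      (n : ℝ) ^ (-(c₁ + c₂ + 1)) := by
    calc (12 * (layerFloor n : ℝ) ^ 2 / n) ^ (K / n + 1 + ⌈4 * (c₁ + c₂ + 1)⌉₊)
        ≤ ((n : ℝ) ^ (-(1 / 4) : ℝ)) ^ (K / n + 1 + ⌈4 * (c₁ + c₂ + 1)⌉₊) := by
          gcongr
          exact final_base_le hn
      _ ≤ ((n : ℝ) ^ (-(1 / 4) : ℝ)) ^ ⌈4 * (c₁ + c₂ + 1)⌉₊ :=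
          pow_le_pow_of_le_one (by positivity)
            (Real.rpow_le_one_of_one_le_of_nonpos hn1 (by norm_num)) (Nat.le_add_left _ _)
      _ = (n : ℝ) ^ (-(1 / 4) * (⌈4 * (c₁ + c₂ + 1)⌉₊ : ℝ)) := by
          rw [Real.rpow_mul hn0.le, Real.rpow_natCast]
      _ ≤ (n : ℝ) ^ (-(c₁ + c₂ + 1)) := by
          refine Real.rpow_le_rpow_of_exponent_le hn1 ?_
          have := Nat.le_ceil (4 * (c₁ + c₂ + 1))
          linarith
  have hsecond : ((T : ℝ) + 1) *
      (12 * (layerFloor n : ℝ) ^ 2 / n) ^ (K / n + 1 + ⌈4 * (c₁ + c₂ + 1)⌉₊) ≤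
      1 / 2 * (n : ℝ) ^ (-(c₁ + 1 / 2)) := by
    calc _ ≤ 2 * (n : ℝ) ^ c₂ * (n : ℝ) ^ (-(c₁ + c₂ + 1)) := by gcongr
      _ = 1 / 2 * (4 * (n : ℝ) ^ (-(c₁ + 1))) := by
          rw [mul_assoc, ← Real.rpow_add hn0, show c₂ + -(c₁ + c₂ + 1) = -(c₁ + 1) by ring]
          ring
      _ ≤ 1 / 2 * ((n : ℝ) ^ (1 / 2 : ℝ) * (n : ℝ) ^ (-(c₁ + 1))) := by gcongr
      _ = _ := by
          rw [← Real.rpow_add hn0]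
          congr 2
          ring
  have : 0 ≤ (n : ℝ) ^ (-(c₁ + 1 / 2)) := by positivity
  linarith

theorem eventually_maxLoad_bound {c₁ : ℝ} (h₁ : 0 ≤ c₁) (c₂ : ℝ) :
    ∀ᶠ n : ℕ in atTop, ∀ K : ℕ, (K : ℝ) < (n : ℝ) ^ c₂ → ∀ T : ℕ, (T : ℝ) ≤ (n : ℝ) ^ c₂ →
      ∀ req : Fin T → Request, Admissible K req →
        1 - (n : ℝ) ^ (-(c₁ + 1 / 2)) ≤ (drawLaw n T).real
          {ω | ∀ t ≤ T, (maxLoad (config req ω t) : ℝ) ≤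
            131 * ((K : ℝ) / n) + Real.log (Real.log n) / Real.log 2 + 560 * (c₁ + c₂)} := by
  have hl2 : 0 < Real.log 2 := Real.log_pos one_lt_two
  have hlog : Tendsto (fun n : ℕ => Real.log (Real.log n) / Real.log 2) atTop atTop :=
    ((Real.tendsto_log_atTop.comp Real.tendsto_log_atTop).comp
      tendsto_natCast_atTop_atTop).atTop_div_const hl2
  rcases le_or_gt c₂ 0 with h₂ | h₂
  · -- Now `K < 1`, so there are never any balls.
    filter_upwards [hlog.eventually_ge_atTop (-(560 * (c₁ + c₂))), eventually_ge_atTop 1]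
      with n hn hn1 K hK T hT req hreq
    have : NeZero n := ⟨by omega⟩
    have hK0 : K = 0 := by
      have : (K : ℝ) < 1 :=
        hK.trans_le (Real.rpow_le_one_of_one_le_of_nonpos (by exact_mod_cast hn1) h₂)
      exact Nat.lt_one_iff.1 (by exact_mod_cast this)
    subst hK0
    have h0 : fewHigh req 1 0 = (Set.univ : Set (Fin T → Fin n × Fin n)) :=
      Set.eq_univ_of_forall fun ω t ht => by
        simpa using (card_highBins_mul_le_card_present req ω 1 t).trans (hreq.card_le t ht)
    refine one_sub_le_drawLaw_real (A := fewHigh req 1 0) (fun ω hω t ht => ?_) ?_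
    · have : maxLoad (config req ω t) = 0 :=
        Nat.lt_one_iff.1 (maxLoad_lt_of_mem_fewHigh hω one_pos ht)
      rw [this]
      simp only [Nat.cast_zero, zero_div, mul_zero, zero_add]
      linarith
    · simp only [h0, Set.compl_univ, measureReal_empty]
      positivity
  rcases le_or_gt (c₁ + c₂) (1 / 4) with hc | hc
  · filter_upwards [hlog.eventually_ge_atTop 1, eventually_ge_atTop 36]
      with n hn hn36 K hK T hT req hreq
    have : NeZero n := ⟨by omega⟩
    refine (no_collision_bound hreq h₁ h₂ hc hn36 hK hT).trans
      (measureReal_mono (fun ω hω t ht => ?_) (measure_ne_top _ _))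
    have h1 : (maxLoad (config req ω t) : ℝ) ≤ 1 := by exact_mod_cast hω t ht
    have h2 : 0 ≤ (K : ℝ) / n := by positivity
    linarith
  · filter_upwards [eventually_failure_le (c₁ := c₁) h₂, eventually_ge_atTop 3]
      with n hfail hn K hK T hT req hreq
    have : NeZero n := ⟨by omega⟩
    refine one_sub_le_drawLaw_real (fun ω hω t ht => ?_) (hfail K T hT req hreq)
    have h1 := maxLoad_lt_of_mem_fewHigh hω
      (Nat.add_pos_right _ (Nat.add_pos_left (Nat.succ_pos _) _)) ht
    have h2 := layerHeight_le (K / n + 1) (layerCount n)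
    have h3 : maxLoad (config req ω t) ≤
        131 * (K / n + 1) + layerCount n + ⌈4 * (c₁ + c₂ + 1)⌉₊ := by omega
    have h4 : (maxLoad (config req ω t) : ℝ) ≤
        131 * (((K / n : ℕ) : ℝ) + 1) + layerCount n + ⌈4 * (c₁ + c₂ + 1)⌉₊ := by
      exact_mod_cast h3
    have h5 : ((K / n : ℕ) : ℝ) ≤ (K : ℝ) / n := Nat.cast_div_le
    have h6 := layerCount_le hn
    have h7 := (Nat.ceil_lt_add_one (show 0 ≤ 4 * (c₁ + c₂ + 1) by linarith)).le
    linarith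

theorem neg_one_le_log_log_div {n : ℕ} (hn : 2 ≤ n) :
    -1 ≤ Real.log (Real.log n) / Real.log 2 := by
  have hl2 : 0 < Real.log 2 := Real.log_pos one_lt_two
  have h := Real.log_two_gt_d9
  have h1 : Real.log 2 ≤ Real.log n := Real.log_le_log two_pos (by exact_mod_cast hn)
  rw [le_div_iff₀ hl2, neg_one_mul, ← Real.log_inv]
  refine Real.log_le_log (by positivity) (le_trans ?_ h1)
  rw [inv_le_comm₀ two_pos hl2, inv_le_comm₀ hl2 two_pos]
  linarith

/-- The rate bound follows from the load bound on every single outcome. -/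
theorem deliveryRate_le {n : ℕ} (S : Config n) {A C κ ℓ R : ℝ} (hA : 0 ≤ A) (hκ : 0 ≤ κ)
    (hℓ : -1 ≤ ℓ) (hR : 0 ≤ R) (h : (maxLoad S : ℝ) ≤ A * κ + ℓ + C) :
    deliveryRate R (load S) ≤ (A + 1 + |C|) * (R * (κ + ℓ + 9)) := by
  rw [deliveryRate, deliveryCalls_load]
  have hC := le_abs_self C
  have hC' := abs_nonneg C
  have h1 : (maxLoad S : ℝ) ≤ (A + 1 + |C|) * (κ + ℓ + 9) := by
    nlinarith [mul_nonneg hA hκ, mul_nonneg hA (by linarith : 0 ≤ ℓ + 1),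
      mul_nonneg hC' hκ, mul_nonneg hC' (by linarith : 0 ≤ ℓ + 1)]
  calc R * (maxLoad S : ℝ) ≤ R * ((A + 1 + |C|) * (κ + ℓ + 9)) := by gcongr
    _ = _ := by ring

end TwoChoice

/-- Here `n` is the number of bins (virtual users) and `K` bounds the number of balls (users)
present. -/
theorem mainTheorem2 :
    ∃ A > (0 : ℝ), ∃ B > (0 : ℝ), ∀ c₁ c₂ : ℝ, ∃ D > (0 : ℝ), ∃ ε : ℕ → ℝ,
      (ε =o[atTop] fun n : ℕ => 1 / (n : ℝ) ^ c₁) ∧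
      ∀ n : ℕ, 2 ≤ n → ∀ K : ℕ, (K : ℝ) < (n : ℝ) ^ c₂ →
      ∀ T : ℕ, (T : ℝ) ≤ (n : ℝ) ^ c₂ →
      ∀ req : Fin T → TwoChoice.Request, TwoChoice.Admissible K req →
        1 - ε n ≤ (TwoChoice.drawLaw n T).real
          {ω | ∀ t ≤ T,
            (TwoChoice.maxLoad (TwoChoice.config req ω t) : ℝ) ≤
                A * ((K : ℝ) / n) + Real.log (Real.log n) / Real.log 2 + B * (c₁ + c₂) ∧
            ∀ R : ℝ, 0 ≤ R →
              TwoChoice.deliveryRate R (TwoChoice.load (TwoChoice.config req ω t)) ≤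
                D * (R * ((K : ℝ) / n + Real.log (Real.log n) / Real.log 2 + 9))} := by
  refine ⟨131, by norm_num, 560, by norm_num, fun c₁ c₂ =>
    ⟨131 + 1 + |560 * (c₁ + c₂)|, by positivity, ?_⟩⟩
  rcases lt_or_ge c₁ 0 with h₁ | h₁
  · -- For negative `c₁` the trivial failure probability `1` is small enough.
    refine ⟨fun _ => 1, ?_, fun n hn K hK T hT req hreq => ?_⟩
    · refine isLittleO_const_left.2 (Or.inr ?_)
      refine tendsto_norm_atTop_atTop.comp ?_
      have := (tendsto_rpow_atTop (neg_pos.2 h₁)).comp (tendsto_natCast_atTop_atTop (R := ℝ))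
      refine this.congr fun n => ?_
      rw [Function.comp_apply, Real.rpow_neg (Nat.cast_nonneg n), one_div]
    · rw [sub_self]
      exact MeasureTheory.measureReal_nonneg
  · obtain ⟨N, hN⟩ := eventually_atTop.1 (TwoChoice.eventually_maxLoad_bound h₁ c₂)
    refine ⟨fun n => if n < N then 1 else (n : ℝ) ^ (-(c₁ + 1 / 2)), ?_,
      fun n hn K hK T hT req hreq => ?_⟩
    · have h0 : (fun n : ℕ => (n : ℝ) ^ (-(c₁ + 1 / 2))) =o[atTop]
          fun n : ℕ => 1 / (n : ℝ) ^ c₁ := by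
        -- The quotient of the two sides is `n ^ (-1 / 2)`.
        have h : Tendsto (fun n : ℕ => (n : ℝ) ^ (-(1 / 2) : ℝ)) atTop (nhds 0) :=
          (tendsto_rpow_neg_atTop one_half_pos).comp tendsto_natCast_atTop_atTop
        have h' := ((isLittleO_one_iff ℝ).2 h).mul_isBigO
          (isBigO_refl (fun n : ℕ => 1 / (n : ℝ) ^ c₁) atTop)
        refine h'.congr' ?_ (.of_forall fun n => one_mul _)
        filter_upwards [eventually_gt_atTop 0] with n hn
        have hn0 : (0 : ℝ) < n := by exact_mod_cast hn
        rw [one_div ((n : ℝ) ^ c₁), ← Real.rpow_neg hn0.le, ← Real.rpow_add hn0]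
        congr 1
        ring
      refine h0.congr' ?_ EventuallyEq.rfl
      filter_upwards [eventually_ge_atTop N] with n hn
      rw [if_neg (not_lt.2 hn)]
    · simp only
      split_ifs with hnN
      · rw [sub_self]
        exact MeasureTheory.measureReal_nonneg
      · have : NeZero n := ⟨by omega⟩
        refine (hN n (not_lt.1 hnN) K hK T hT req hreq).trans
          (MeasureTheory.measureReal_mono (fun ω hω t ht => ⟨hω t ht, fun R hR => ?_⟩)
            (MeasureTheory.measure_ne_top _ _))
        exact TwoChoice.deliveryRate_le _ (by norm_num) (by positivity)
          (TwoChoice.neg_one_le_log_log_div hn) hR (hω t ht)
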